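/- **Setting.** Let $\mathbb T$ be a commutative semiring (addition $\oplus$, multiplication $\odot$, zero $\mathbb 0$, unit $\mathbb 1$) with a symmetry, that is, a map $a\mapsto\ominus a$ satisfying $\ominus(a\oplus b)=(\ominus a)\oplus(\ominus b)$, $\ominus\mathbb 0=\mathbb 0$, $\ominus(ab)=a(\ominus b)=(\ominus a)b$ and $\ominus(\ominus a)=a$ (the identity map is allowed). Put $a^\circ=a\oplus(\ominus a)$, $\mathbb T^\circ=\{a^\circ: a\in\mathbb T\}$, and $$a\preccurlyeq b\iff b=a\oplus c\text{ for some }c\in\mathbb T,\qquad a\succeq^\circ b\iff a=b\oplus c\text{ for some }c\in\mathbb T^\circ.$$ Let $\mathbb T^*$ be the set of invertible elements of $\mathbb T$ and $\mathbb T^\vee=\mathbb T^*\cup\{\mathbb 0\}$. Assume that * $\mathbb T$ is naturally ordered, i.e. $\preccurlyeq$ is antisymmetric; * $\mathbb T$ has a modulus $a\mapsto|a|$, i.e. a surjective morphism of semirings onto a semifield $\mathbb M$ that is idempotent and totally ordered by its natural order; * $|a|\prec|b|$ implies $a\oplus b=b$; * $a\preccurlyeq b$, $|a|=|b|$ and $b\in\mathbb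 T^\vee$ imply $a=b$; * $a^\circ\oplus a^\circ=a^\circ$ for all $a\in\mathbb T$. For $A\in\mathbb T^{n\times n}$ and subsets $I,J$ of $[n]$ of the same cardinality $k$, define the $k$-th compound matrix by $$A^{\wedge k}_{I,J}=\bigoplus_{\sigma:I\to J\text{ bijective}}(\ominus\mathbb 1)^{|\mathrm{inv}(\sigma)|}\bigodot_{i\in I}A_{i,\sigma(i)},\qquad \mathrm{inv}(\sigma)=\{(i,j)\in I^2: i<j,\ \sigma(i)>\sigma(j)\},$$ and put $\det(A)=A^{\wedge n}_{[n],[n]}$. The trace $\mathrm{tr}$ of a square matrix is the sum of its diagonal entries. The matrix $A$ is nonsingular if $\det(A)\in\mathbb T^*$; then its quasi-inverse is $A^\nabla=\det(A)^{-1}\mathrm{adj}(A)$, where $\mathrm{adj}(A)_{i,j}=(\ominus\mathbb 1)^{i+j}\det(A_{(j,i)})$ and $A_{(j,i)}$ is $A$ with row $j$ and column $i$ deleted. The supertropical semiring is the set $\mathbb R\cup\mathbb R^\nu\cup\{-\infty\}$, where $\mathbb R^\nu$ is a second copy of $\mathbb R$ and $a\mapsto a^\nu$ sends $a\in\mathbb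 R$ to its copy and fixes the elements of $\mathbb R^\nu\cup\{-\infty\}$, which are ordered as $\mathbb R\cup\{-\infty\}$. Here $a\oplus b$ is $a$ if $a^\nu>b^\nu$, $b$ if $b^\nu>a^\nu$, and $a^\nu$ if $a^\nu=b^\nu$. The product adds real values, is in $\mathbb R^\nu$ as soon as one factor is and neither factor is $-\infty$, and is $-\infty$ if one factor is $-\infty$. Its symmetry is the identity map. On it, $a\models b$ means that $a=b\oplus c^\nu$ for some $c\in\mathbb R\cup\{-\infty\}$. **Corollary.** Let $A\in\mathbb T^{n\times n}$ be nonsingular and $k\in\{0,\dots,n\}$. Then $$\det(A)\,\mathrm{tr}\big((A^\nabla)^{\wedge n-k}\big)\succeq^\circ\mathrm{tr}\big(A^{\wedge k}\big).$$ If moreover $\ominus\mathbb 1=\mathbb 1$, then for all $I,J\subseteq[n]$ with $|I|=|J|=k$, writing $I^c,J^c$ for their complements in $[n]$, $$\det(A)\,\big(A^\nabla\big)^{\wedge n-k}_{J^c,I^c}\succeq^\circ A^{\wedge k}_{I,J}.$$ In particular, for every nonsingular $A\in(\mathbb R\cup\mathbb R^\nu\cup\{-\infty\})^{n\times n}$ over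 the supertropical semiring, every $k\in\{0,\dots,n\}$ and all such $I,J$, $$\det(A)\,\big(A^\nabla\big)^{\wedge n-k}_{J^c,I^c}\models A^{\wedge k}_{I,J}.$$ -/

import Mathlib

/-! ### Semirings with a symmetry

A symmetry of a commutative semiring `S` is an additive map `τ` with `τ 0 = 0`,
`τ (a * b) = a * τ b = τ a * b` and `τ (τ a) = a`. This is exactly Mathlib's `HasDistribNeg S`, with
`τ a` written `-a`: additivity and `τ 0 = 0` follow from the other laws, as the next two lemmas
recall. Thus `-a` below is the symmetry; it is *not* an additive inverse, and it may be the
identity map. -/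

namespace SymTrop

universe u v

theorem symm_add {S : Type u} [CommSemiring S] [HasDistribNeg S] (a b : S) :
    -(a + b) = -a + -b := by
  rw [← neg_one_mul, mul_add, neg_one_mul, neg_one_mul]

theorem symm_zero {S : Type u} [CommSemiring S] [HasDistribNeg S] : -(0 : S) = 0 := neg_zero

/-- `a° = a ⊕ (⊖ a)`. -/
def circ {S : Type u} [CommSemiring S] [HasDistribNeg S] (a : S) : S := a + -a

/-- The set `S° = {a° | a ∈ S}`. -/
def circSet (S : Type u) [CommSemiring S] [HasDistribNeg S] : Set S := Set.range (circ (S := S))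

/-- The relation `a ≽° b`: `a = b ⊕ c` for some `c ∈ S°`. -/
def CircGE {S : Type u} [CommSemiring S] [HasDistribNeg S] (a b : S) : Prop :=
  ∃ c ∈ circSet S, a = b + c

/-- The natural preorder `a ≼ b`: `b = a ⊕ c` for some `c`. -/
def NatLE {S : Type u} [CommSemiring S] (a b : S) : Prop := ∃ c, b = a + c

/-- `a ≺ b` for the natural preorder: `a ≼ b` and `a ≠ b`. -/
def NatLT {S : Type u} [CommSemiring S] (a b : S) : Prop := NatLE a b ∧ a ≠ b

/-- A semiring is naturally ordered when its natural preorder is antisymmetric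
(it is always reflexive and transitive). -/
def NaturallyOrdered (S : Type u) [CommSemiring S] : Prop :=
  ∀ a b : S, NatLE a b → NatLE b a → a = b

/-- A totally ordered idempotent semifield: the addition is idempotent, `0 ≠ 1`, every nonzero
element is invertible, and the natural order is total. (Mathlib's `IsField` does not require
additive inverses when it is used for a semiring.) -/
structure IsTotallyOrderedIdempotentSemifield (M : Type v) [CommSemiring M] : Prop where
  isField : IsField M
  add_self : ∀ a : M, a + a = a
  total : ∀ a b : M, NatLE a b ∨ NatLE b a

/-- The standing assumptions on a commutative semiring with symmetry `T` and its modulus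
`μ : T → M`, written `|a| = μ a`. An element of `T^∨` is one that is invertible or zero. -/
structure IsTropicalWithModulus {T : Type u} {M : Type v} [CommSemiring T] [HasDistribNeg T]
    [CommSemiring M] (μ : T →+* M) : Prop where
  naturallyOrdered : NaturallyOrdered T
  semifield : IsTotallyOrderedIdempotentSemifield M
  /-- A modulus is a surjective morphism of semirings. -/
  surjective : Function.Surjective μ
  /-- `|a| ≺ |b|` implies `a ⊕ b = b`. -/
  add_eq_of_modulus_lt : ∀ a b : T, NatLT (μ a) (μ b) → a + b = b
  /-- `b ≽ a`, `|a| = |b|` and `b ∈ T^∨` imply `a = b`. -/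
  eq_of_le_of_modulus_eq : ∀ a b : T, NatLE a b → μ a = μ b → (IsUnit b ∨ b = 0) → a = b
  /-- `T°` is idempotent. -/
  circ_add_circ : ∀ a : T, circ a + circ a = circ a

/-! ### Determinants, compound matrices, quasi-inverse -/

/-- The number of inversions of a bijection between two finite totally ordered sets. -/
def invCount {I J : Type*} [Fintype I] [LinearOrder I] [LinearOrder J] (σ : I ≃ J) : ℕ :=
  (Finset.univ.filter fun p : I × I => p.1 < p.2 ∧ σ p.2 < σ p.1).card

/-- The sum, over all bijections `σ : I → J`, of `(⊖ 1) ^ |inv σ| ⊙ ∏ i, A i (σ i)`. -/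
def bijDet {S : Type u} [CommSemiring S] [HasDistribNeg S] {I J : Type*} [Fintype I] [Fintype J]
    [LinearOrder I] [LinearOrder J] (A : Matrix I J S) : S :=
  ∑ σ : I ≃ J, (-1) ^ invCount σ * ∏ i, A i (σ i)

/-- The determinant of a square matrix over a semiring with symmetry. -/
def tdet {S : Type u} [CommSemiring S] [HasDistribNeg S] {n : ℕ}
    (A : Matrix (Fin n) (Fin n) S) : S :=
  bijDet A

/-- A matrix is nonsingular when its determinant is invertible in `S`. -/
def Nonsing {S : Type u} [CommSemiring S] [HasDistribNeg S] {n : ℕ}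
    (A : Matrix (Fin n) (Fin n) S) : Prop :=
  IsUnit (tdet A)

/-- The adjoint matrix: its `(i, j)` entry is `(⊖ 1) ^ (i + j)` times the determinant of the
matrix obtained from `A` by deleting row `j` and column `i`. (Numbering the indices from `0`
instead of `1` does not change the parity of `i + j`.) -/
def tadj {S : Type u} [CommSemiring S] [HasDistribNeg S] {n : ℕ}
    (A : Matrix (Fin n) (Fin n) S) : Matrix (Fin n) (Fin n) S :=
  Matrix.of fun i j => (-1) ^ ((i : ℕ) + (j : ℕ)) *
    bijDet (A.submatrix (fun r : {r : Fin n // r ≠ j} => (r : Fin n))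
      (fun c : {c : Fin n // c ≠ i} => (c : Fin n)))

/-- The quasi-inverse `A^∇ = adj(A) det(A)⁻¹`, meaningful for nonsingular `A`: on an invertible
element `Ring.inverse` is the inverse. -/
noncomputable def quasiInv {S : Type u} [CommSemiring S] [HasDistribNeg S] {n : ℕ}
    (A : Matrix (Fin n) (Fin n) S) : Matrix (Fin n) (Fin n) S :=
  Matrix.of fun i j => tadj A i j * Ring.inverse (tdet A)

/-- The subsets of `[n]` of cardinality `k`. -/
abbrev KSubset (n k : ℕ) : Type := {I : Finset (Fin n) // I.card = k}

/-- The complement `I^c`, of cardinality `n - k`. -/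
def KSubset.compl {n k : ℕ} (I : KSubset n k) : KSubset n (n - k) :=
  ⟨I.1ᶜ, by rw [Finset.card_compl, Fintype.card_fin, I.2]⟩

/-- The `k`-th compound matrix, indexed by the subsets of cardinality `k`. -/
def compound {S : Type u} [CommSemiring S] [HasDistribNeg S] {n : ℕ} (k : ℕ)
    (A : Matrix (Fin n) (Fin n) S) : Matrix (KSubset n k) (KSubset n k) S :=
  Matrix.of fun I J => bijDet (A.submatrix (fun i : {i // i ∈ I.1} => (i : Fin n))
    (fun j : {j // j ∈ J.1} => (j : Fin n)))

/-! ### The supertropical semiring -/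

/-- The set `ℝ ∪ ℝ^ν ∪ {-∞}`: the zero `-∞`, the tangible elements (the copy of `ℝ`) and the ghost
elements (the copy `ℝ^ν`). -/
inductive Supertropical : Type where
  | bot : Supertropical
  | tangible (r : ℝ) : Supertropical
  | ghost (r : ℝ) : Supertropical

namespace Supertropical

/-- The element of `ℝ ∪ {-∞}` that lies below a supertropical number; it serves to compare
`a^ν` with `b^ν`. -/
def level : Supertropical → WithBot ℝ
  | bot => ⊥
  | tangible r => r
  | ghost r => r

/-- The ghost map `a ↦ a^ν`. -/
def nu : Supertropical → Supertropical
  | bot => bot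
  | tangible r => ghost r
  | ghost r => ghost r

/-- The inclusion of the set `ℝ ∪ {-∞}` as the tangible elements and the zero. -/
def ofReal : WithBot ℝ → Supertropical
  | none => bot
  | some r => tangible r

open Classical in
/-- `a ⊕ b` is `a` if `a^ν > b^ν`, `b` if `b^ν > a^ν`, and `a^ν` if `a^ν = b^ν`. -/
noncomputable instance : Add Supertropical :=
  ⟨fun a b => if level b < level a then a else if level a < level b then b else nu a⟩

/-- The multiplication adds real values; a product is ghost as soon as one factor is, and `-∞`
is absorbing. -/
noncomputable instance : Mul Supertropical :=
  ⟨fun a b =>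
    match a, b with
    | bot, _ => bot
    | _, bot => bot
    | tangible r, tangible s => tangible (r + s)
    | tangible r, ghost s => ghost (r + s)
    | ghost r, tangible s => ghost (r + s)
    | ghost r, ghost s => ghost (r + s)⟩

instance : Zero Supertropical := ⟨bot⟩

noncomputable instance : One Supertropical := ⟨tangible 0⟩

open Classical in
theorem add_def (a b : Supertropical) :
    a + b = if level b < level a then a else if level a < level b then b else nu a := rfl

theorem zero_def : (0 : Supertropical) = bot := rfl

theorem one_def : (1 : Supertropical) = tangible 0 := rfl

theorem bot_mul (a : Supertropical) : bot * a = bot := rfl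

theorem mul_bot (a : Supertropical) : a * bot = bot := by cases a <;> rfl

theorem tangible_mul_tangible (r s : ℝ) : tangible r * tangible s = tangible (r + s) := rfl

theorem tangible_mul_ghost (r s : ℝ) : tangible r * ghost s = ghost (r + s) := rfl

theorem ghost_mul_tangible (r s : ℝ) : ghost r * tangible s = ghost (r + s) := rfl

theorem ghost_mul_ghost (r s : ℝ) : ghost r * ghost s = ghost (r + s) := rfl

theorem level_nu (a : Supertropical) : level (nu a) = level a := by cases a <;> rfl

theorem nu_nu (a : Supertropical) : nu (nu a) = nu a := by cases a <;> rfl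

theorem nu_eq_nu {a b : Supertropical} (h : level a = level b) : nu a = nu b := by
  cases a <;> cases b <;> simp_all [level, nu]

theorem add_of_lt {a b : Supertropical} (h : level a < level b) : a + b = b := by
  rw [add_def, if_neg h.not_gt, if_pos h]

theorem add_of_gt {a b : Supertropical} (h : level b < level a) : a + b = a := by
  rw [add_def, if_pos h]

theorem add_of_eq {a b : Supertropical} (h : level a = level b) : a + b = nu a := by
  rw [add_def, if_neg h.not_gt, if_neg h.not_lt]

protected theorem add_comm (a b : Supertropical) : a + b = b + a := by
  rcases lt_trichotomy (level a) (level b) with h | h | h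
  · rw [add_of_lt h, add_of_gt h]
  · rw [add_of_eq h, add_of_eq h.symm, nu_eq_nu h]
  · rw [add_of_gt h, add_of_lt h]

theorem level_add (a b : Supertropical) : level (a + b) = max (level a) (level b) := by
  rcases lt_trichotomy (level a) (level b) with h | h | h
  · rw [add_of_lt h, max_eq_right h.le]
  · rw [add_of_eq h, level_nu, h, max_self]
  · rw [add_of_gt h, max_eq_left h.le]

protected theorem add_assoc (a b c : Supertropical) : a + b + c = a + (b + c) := by
  rcases lt_trichotomy (level a) (level b) with h | h | h <;>
  rcases lt_trichotomy (level b) (level c) with h' | h' | h'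
  · rw [add_of_lt h, add_of_lt h', add_of_lt (h.trans h')]
  · rw [add_of_lt h, add_of_eq h', add_of_lt (by rwa [level_nu])]
  · rw [add_of_lt h, add_of_gt h', add_of_lt h]
  · rw [add_of_eq h, add_of_lt h', add_of_lt (by rwa [level_nu, h]), add_of_lt (by rwa [h])]
  · rw [add_of_eq h, add_of_eq h', add_of_eq (by rw [level_nu, h, h']), nu_nu,
      add_of_eq (by rw [level_nu, h])]
  · rw [add_of_eq h, add_of_gt h', add_of_gt (by rwa [level_nu, h]), add_of_eq h]
  · rw [add_of_gt h, add_of_lt h']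
  · rw [add_of_gt h, add_of_eq h', add_of_gt (by rwa [← h']), add_of_gt (by rwa [level_nu])]
  · rw [add_of_gt h, add_of_gt h', add_of_gt (h'.trans h), add_of_gt h]

protected theorem zero_add (a : Supertropical) : 0 + a = a := by
  cases a with
  | bot => exact add_of_eq rfl
  | tangible r => exact add_of_lt (WithBot.bot_lt_coe r)
  | ghost r => exact add_of_lt (WithBot.bot_lt_coe r)

protected theorem mul_comm (a b : Supertropical) : a * b = b * a := by
  cases a <;> cases b <;>
    simp [bot_mul, mul_bot, tangible_mul_tangible, tangible_mul_ghost, ghost_mul_tangible,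
      ghost_mul_ghost, add_comm]

protected theorem mul_assoc (a b c : Supertropical) : a * b * c = a * (b * c) := by
  cases a <;> cases b <;> cases c <;>
    simp [bot_mul, mul_bot, tangible_mul_tangible, tangible_mul_ghost, ghost_mul_tangible,
      ghost_mul_ghost, add_assoc]

protected theorem one_mul (a : Supertropical) : 1 * a = a := by
  cases a <;> simp [one_def, mul_bot, tangible_mul_tangible, tangible_mul_ghost]

theorem level_mul (a b : Supertropical) : level (a * b) = level a + level b := by
  cases a <;> cases b <;> simp only [level, WithBot.bot_add, WithBot.add_bot] <;> rfl

theorem mul_nu (a b : Supertropical) : a * nu b = nu (a * b) := by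
  cases a <;> cases b <;> rfl

protected theorem mul_add (a b c : Supertropical) : a * (b + c) = a * b + a * c := by
  by_cases ha : level a = ⊥
  · cases a with
    | bot => rw [bot_mul, bot_mul, bot_mul]; exact (Supertropical.zero_add bot).symm
    | tangible r => exact absurd ha (WithBot.coe_ne_bot)
    | ghost r => exact absurd ha (WithBot.coe_ne_bot)
  · rcases lt_trichotomy (level b) (level c) with h | h | h
    · rw [add_of_lt h, add_of_lt]
      rw [level_mul, level_mul]; exact WithBot.add_lt_add_left ha h
    · rw [add_of_eq h, add_of_eq (by rw [level_mul, level_mul, h]), mul_nu]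
    · rw [add_of_gt h, add_of_gt]
      rw [level_mul, level_mul]; exact WithBot.add_lt_add_left ha h

noncomputable instance : CommSemiring Supertropical where
  add_assoc := Supertropical.add_assoc
  zero_add := Supertropical.zero_add
  add_zero a := by rw [Supertropical.add_comm, Supertropical.zero_add]
  add_comm := Supertropical.add_comm
  nsmul := nsmulRec
  mul_assoc := Supertropical.mul_assoc
  one_mul := Supertropical.one_mul
  mul_one a := by rw [Supertropical.mul_comm, Supertropical.one_mul]
  mul_comm := Supertropical.mul_comm
  left_distrib := Supertropical.mul_add
  right_distrib a b c := by
    rw [Supertropical.mul_comm, Supertropical.mul_add, Supertropical.mul_comm c a,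
      Supertropical.mul_comm c b]
  zero_mul := bot_mul
  mul_zero := mul_bot

/-- The symmetry of the supertropical semiring is the identity map. -/
instance : HasDistribNeg Supertropical where
  neg a := a
  neg_neg _ := rfl
  neg_mul _ _ := rfl
  mul_neg _ _ := rfl

/-- The relation `a ⊨ b`: `a = b ⊕ c^ν` for some `c ∈ ℝ ∪ {-∞}`. -/
def Models (a b : Supertropical) : Prop := ∃ c : WithBot ℝ, a = b + nu (ofReal c)

end Supertropical

end SymTrop

/-!
Over a commutative ring, Jacobi's identity says that
`(adj A)^∧(n-k) (Jᶜ, Iᶜ) = ± det A ^ (n-k-1) * A^∧k (I, J)`, the sign being `+` for `I = J`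
(`compound_adjugate_compl`). Here it is transferred to a semiring with symmetry.

Both sides are evaluated on the generic matrix over the semiring of formal sums of signed monomials,
in which `p` and `-p` do not cancel. There they become formal sums `L` and `R`, and the classical
identity says that, for each monomial `p`, the multiplicities of `p` and `-p` have the same
difference in `L` as in `R`.

The assumptions on the modulus enter through one consequence: the invertible element `det A` equals
one of its terms, the term of some permutation `π` (`exists_tdet_eq_term`). Write
`det A ^ (n-k-1) * A^∧k (I, J) = D + N`, where `D` replaces the power of the determinant by the power
of the formal term of `π`. Then `D` and `R = D + N` have the same value at `A`; hence, by natural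
order, the value of `D` absorbs every part of the value of `N`. Moreover the terms of `R` with the
same monomial as a term of `D` all have the sign of that term (`sign_eq_of_monomial_eq`), by a
comparison of the edges of permutations (`sign_eq_of_edges_eq`). So for each monomial `p`, of value
`w` at `A`, either `p` and `-p` both occur in `L`, which contributes `w°`, because `w°` absorbs all
copies of `w` and `-w`; or only one of them does, and then `L` contains the part of `D` at `p`,
together with terms of `N`, which are absorbed. Therefore `L ≽° D` after evaluation
(`circGE_evalSigned`, `circGE_compound_tadj`).

The supertropical semiring is naturally ordered, has `a° = a^ν`, and an invertible sum of two of its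
elements is one of them, so the same argument applies to it without the choice of a modulus.
-/

namespace SymTrop

open Equiv Matrix

/-! ### Bijection sums: naturality and comparison with the determinant -/

section Naturality

variable {S S' : Type*} [CommSemiring S] [HasDistribNeg S] [CommSemiring S'] [HasDistribNeg S']

theorem map_bijDet (f : S →+* S') (hf : f (-1) = -1) {I J : Type*} [Fintype I] [Fintype J]
    [LinearOrder I] [LinearOrder J] (A : Matrix I J S) :
    f (bijDet A) = bijDet (A.map f) := by
  simp [bijDet, map_sum, map_prod, map_pow, hf]

theorem map_tdet (f : S →+* S') (hf : f (-1) = -1) {n : ℕ} (A : Matrix (Fin n) (Fin n) S) :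
    f (tdet A) = tdet (A.map f) :=
  map_bijDet f hf A

theorem map_compound (f : S →+* S') (hf : f (-1) = -1) {n : ℕ} (k : ℕ)
    (A : Matrix (Fin n) (Fin n) S) (I J : KSubset n k) :
    f (compound k A I J) = compound k (A.map f) I J :=
  map_bijDet f hf _

theorem map_tadj (f : S →+* S') (hf : f (-1) = -1) {n : ℕ} (A : Matrix (Fin n) (Fin n) S) :
    (tadj A).map f = tadj (A.map f) := by
  ext i j
  simp only [tadj, map_apply, of_apply, map_mul, map_pow, hf, map_bijDet f hf]
  rfl

end Naturality

section Reindexing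

variable {S : Type*} [CommSemiring S] [HasDistribNeg S]

theorem invCount_equivCongr {I J I' J' : Type*} [Fintype I] [Fintype I'] [LinearOrder I]
    [LinearOrder J] [LinearOrder I'] [LinearOrder J'] (e : I' ≃o I) (e' : J' ≃o J) (σ : I' ≃ J') :
    invCount (Equiv.equivCongr e.toEquiv e'.toEquiv σ) = invCount σ := by
  refine (Finset.card_equiv (e.toEquiv.prodCongr e.toEquiv) ?_).symm
  rintro ⟨a, b⟩
  simp

/-- The bijection sum depends only on the order types of the index sets. -/
theorem bijDet_submatrix_orderIso {I J I' J' : Type*} [Fintype I] [Fintype J] [Fintype I']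
    [Fintype J'] [LinearOrder I] [LinearOrder J] [LinearOrder I'] [LinearOrder J']
    (e : I' ≃o I) (e' : J' ≃o J) (A : Matrix I J S) :
    bijDet (A.submatrix e e') = bijDet A := by
  refine Fintype.sum_equiv (Equiv.equivCongr e.toEquiv e'.toEquiv) _ _ fun σ => ?_
  rw [invCount_equivCongr]
  congr 1
  refine Fintype.prod_equiv e.toEquiv _ _ fun i => ?_
  simp

end Reindexing

/-- The parity of the number of inversions of a permutation of `Fin k` is its signature. -/
theorem neg_one_pow_invCount {k : ℕ} (σ : Perm (Fin k)) :
    (-1 : ℤˣ) ^ invCount σ = Perm.sign σ := by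
  rw [Perm.sign_eq_prod_prod_Ioi, invCount, ← Finset.prod_const, Finset.prod_filter,
    ← Finset.univ_product_univ, Finset.prod_product]
  refine Finset.prod_congr rfl fun i _ => ?_
  rw [← Finset.prod_subset (Finset.subset_univ (Finset.Ioi i))]
  · refine Finset.prod_congr rfl fun j hj => ?_
    rw [Finset.mem_Ioi] at hj
    have : σ i ≠ σ j := fun h => hj.ne (σ.injective h)
    by_cases h : σ i < σ j
    · simp [h, h.not_gt]
    · have h' : σ j < σ i := lt_of_le_of_ne (not_lt.1 h) this.symm
      simp [h, h', hj]
  · intro j _ hj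
    rw [Finset.mem_Ioi] at hj
    simp [hj]

theorem bijDet_eq_det {R : Type*} [CommRing R] {k : ℕ} (A : Matrix (Fin k) (Fin k) R) :
    bijDet A = A.det := by
  rw [← det_transpose, det_apply', bijDet]
  refine Finset.sum_congr rfl fun σ _ => ?_
  rw [← neg_one_pow_invCount]
  simp

theorem tdet_eq_det {R : Type*} [CommRing R] {n : ℕ} (A : Matrix (Fin n) (Fin n) R) :
    tdet A = A.det := bijDet_eq_det A

theorem tadj_eq_adjugate {R : Type*} [CommRing R] {n : ℕ} (A : Matrix (Fin n) (Fin n) R) :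
    tadj A = A.adjugate := by
  cases n with
  | zero => exact Subsingleton.elim _ _
  | succ n =>
    ext i j
    rw [adjugate_fin_succ_eq_det_submatrix, ← bijDet_eq_det]
    simp only [tadj, of_apply]
    rw [add_comm (i : ℕ)]
    congr 1
    let e (p : Fin (n + 1)) : Fin n ≃o {x : Fin (n + 1) // x ≠ p} :=
      { finSuccAboveEquiv p with
        map_rel_iff' := by
          intro a b
          exact (Fin.succAboveOrderEmb p).le_iff_le }
    exact (bijDet_submatrix_orderIso (e j) (e i) _).symm

/-- The increasing enumeration of a `k`-subset of `[n]`. -/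
def KSubset.enum {n k : ℕ} (I : KSubset n k) : Fin k ≃o {i // i ∈ I.1} :=
  I.1.orderIsoOfFin I.2

/-- The increasing enumeration of a `k`-subset followed by that of its complement. -/
def KSubset.split {n k : ℕ} (I : KSubset n k) : Fin k ⊕ Fin (n - k) ≃ Fin n :=
  (I.enum.toEquiv.sumCongr (I.compl.enum.toEquiv.trans
    (Equiv.subtypeEquivRight fun _ => Finset.mem_compl))).trans (Equiv.sumCompl (· ∈ I.1))

theorem compound_eq_bijDet {S : Type*} [CommSemiring S] [HasDistribNeg S] {n k : ℕ}
    (A : Matrix (Fin n) (Fin n) S) (I J : KSubset n k) :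
    compound k A I J = bijDet (A.submatrix (I.split ∘ Sum.inl) (J.split ∘ Sum.inl)) := by
  rw [compound, of_apply, ← bijDet_submatrix_orderIso I.enum J.enum]
  rfl

theorem compound_compl_eq_bijDet {S : Type*} [CommSemiring S] [HasDistribNeg S] {n k : ℕ}
    (A : Matrix (Fin n) (Fin n) S) (I J : KSubset n k) :
    compound (n - k) A I.compl J.compl =
      bijDet (A.submatrix (I.split ∘ Sum.inr) (J.split ∘ Sum.inr)) := by
  rw [compound, of_apply, ← bijDet_submatrix_orderIso I.compl.enum J.compl.enum]
  rfl

/-- The sign relating the block decompositions of a matrix along the subsets `I` and `J`. It is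
`1` when `I = J`. -/
def splitSign {n k : ℕ} (I J : KSubset n k) : ℤˣ := Perm.sign (I.split.symm.trans J.split)

theorem splitSign_self {n k : ℕ} (I : KSubset n k) : splitSign I I = 1 := by
  simp [splitSign]

theorem det_submatrix_split {R : Type*} [CommRing R] {n k : ℕ} (X : Matrix (Fin n) (Fin n) R)
    (I J : KSubset n k) :
    (X.submatrix I.split J.split).det = (splitSign I J : ℤ) * X.det := by
  have : X.submatrix I.split J.split =
      (X.submatrix id (I.split.symm.trans J.split)).submatrix I.split I.split := by
    ext a b; simp
  rw [this, det_submatrix_equiv_self, det_permute', splitSign]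

/-- Jacobi's identity on complementary minors of the adjugate. One determinant is cancelled, hence
the assumption that it is not a zero divisor. -/
theorem compound_adjugate_compl {R : Type*} [CommRing R] [IsDomain R] {n k : ℕ}
    (X : Matrix (Fin n) (Fin n) R) (hX : X.det ≠ 0) {r : ℕ} (hr : n - k = r + 1)
    (I J : KSubset n k) :
    compound (n - k) X.adjugate J.compl I.compl =
      (splitSign I J : ℤ) * (X.det ^ r * compound k X I J) := by
  rw [compound_compl_eq_bijDet, compound_eq_bijDet, bijDet_eq_det, bijDet_eq_det]
  set X' := X.submatrix I.split J.split with hX'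
  set Y := X.adjugate.submatrix J.split I.split with hY
  have hmul : X' * Y = X.det • (1 : Matrix (Fin k ⊕ Fin (n - k)) (Fin k ⊕ Fin (n - k)) R) := by
    rw [hX', hY, submatrix_mul_equiv, mul_adjugate, submatrix_smul, Pi.smul_apply, Pi.smul_apply,
      submatrix_one_equiv]
  -- Replace the first block of columns of `Y` by columns of the identity matrix.
  have hblock : X' * fromBlocks 1 Y.toBlocks₁₂ 0 Y.toBlocks₂₂ =
      fromBlocks X'.toBlocks₁₁ 0 X'.toBlocks₂₁ (X.det • 1) := by
    have hXY := hmul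
    rw [← fromBlocks_toBlocks X', ← fromBlocks_toBlocks Y, fromBlocks_multiply,
      ← fromBlocks_one, fromBlocks_smul, fromBlocks_inj] at hXY
    nth_rewrite 1 [← fromBlocks_toBlocks X']
    rw [fromBlocks_multiply, hXY.2.1, hXY.2.2.2]
    simp
  have hdet := congrArg det hblock
  rw [det_mul, det_fromBlocks_zero₂₁, det_fromBlocks_zero₁₂, det_smul, det_submatrix_split] at hdet
  simp only [det_one, one_mul, mul_one, Fintype.card_fin] at hdet
  have hpow : X.det ^ (n - k) = X.det ^ r * X.det := by rw [hr, pow_succ]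
  rw [hpow] at hdet
  have hε : ((splitSign I J : ℤ) : R) * (splitSign I J : ℤ) = 1 := by
    rw [← Int.cast_mul, ← Units.val_mul, Int.units_mul_self]; simp
  have h1 : Y.toBlocks₂₂ = X.adjugate.submatrix (J.split ∘ Sum.inr) (I.split ∘ Sum.inr) := rfl
  have h2 : X'.toBlocks₁₁ = X.submatrix (I.split ∘ Sum.inl) (J.split ∘ Sum.inl) := rfl
  rw [h1, h2] at hdet
  refine mul_left_cancel₀ hX ?_
  linear_combination (splitSign I J : ℤ) * hdet -
    X.det * (X.adjugate.submatrix (J.split ∘ Sum.inr) (I.split ∘ Sum.inr)).det * hε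

/-! ### Formal signed polynomials -/

/-- The formal sums, with coefficients in `ℕ`, of signed monomials `± p`, where `p` belongs to a
commutative monoid `P`. The terms `+ p` and `- p` do not cancel. -/
abbrev SignedSum (P : Type*) [CommMonoid P] : Type _ := MonoidAlgebra ℕ (ℤˣ × P)

noncomputable instance {P : Type*} [CommMonoid P] : HasDistribNeg (SignedSum P) where
  neg x := MonoidAlgebra.single (-1, 1) 1 * x
  neg_neg x := by
    rw [← mul_assoc, MonoidAlgebra.single_mul_single]
    simp [← Prod.one_eq_mk, ← MonoidAlgebra.one_def]
  neg_mul x y := mul_assoc _ x y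
  mul_neg x y := mul_left_comm x _ y

theorem SignedSum.neg_one_eq {P : Type*} [CommMonoid P] :
    (-1 : SignedSum P) = MonoidAlgebra.single (-1, 1) 1 :=
  mul_one (MonoidAlgebra.single ((-1 : ℤˣ), (1 : P)) 1)

/-- The interpretation of signs in a semiring with symmetry. -/
def signHom (T : Type*) [CommSemiring T] [HasDistribNeg T] : ℤˣ →* T where
  toFun s := if s = 1 then 1 else -1
  map_one' := if_pos rfl
  map_mul' s t := by
    rcases Int.units_eq_one_or s with rfl | rfl <;>
      rcases Int.units_eq_one_or t with rfl | rfl <;> simp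

section Eval

variable {T : Type*} [CommSemiring T] [HasDistribNeg T] {P : Type*} [CommMonoid P]

theorem signHom_neg_one : signHom T (-1) = (-1 : T) := by
  simp [signHom]

/-- The evaluation of formal signed sums that extends a valuation `ψ` of the monomials. -/
noncomputable def evalSigned (ψ : P →* T) : SignedSum P →+* T :=
  (MonoidAlgebra.lift ℕ T (ℤˣ × P) ((signHom T).coprod ψ)).toRingHom

theorem evalSigned_single (ψ : P →* T) (s : ℤˣ) (p : P) :
    evalSigned ψ (MonoidAlgebra.single (s, p) 1) = signHom T s * ψ p := by
  simp [evalSigned]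

theorem evalSigned_neg_one (ψ : P →* T) : evalSigned ψ (-1) = -1 := by
  rw [SignedSum.neg_one_eq, evalSigned_single, signHom_neg_one, map_one, mul_one]

theorem evalSigned_eq_sum (ψ : P →* T) (x : SignedSum P) (s : Finset P)
    (hs : ∀ g, x.coeff g ≠ 0 → g.2 ∈ s) :
    evalSigned ψ x = ∑ p ∈ s, (x.coeff (1, p) • ψ p + x.coeff (-1, p) • -ψ p) := by
  have h : evalSigned ψ x = x.coeff.sum fun g c => c • (signHom T g.1 * ψ g.2) := by
    simp [evalSigned, MonoidAlgebra.lift_apply]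
  rw [h, Finsupp.sum_of_support_subset _ (s := Finset.univ ×ˢ s) _ _ (by simp),
    Finset.sum_product_right]
  · refine Finset.sum_congr rfl fun p _ => ?_
    rw [UnitsInt.univ, Finset.sum_pair (by decide)]
    simp [signHom_neg_one]
  · intro g hg
    exact Finset.mem_product.2 ⟨Finset.mem_univ _, hs g (Finsupp.mem_support_iff.1 hg)⟩

end Eval

/-! ### Absorption in naturally ordered semirings -/

section Absorption

variable {T : Type*} [CommSemiring T]

/-- In a naturally ordered semiring, an element that absorbs a sum absorbs its summands. -/
theorem NaturallyOrdered.add_eq_left (hord : NaturallyOrdered T) {d x y : T}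
    (h : d + (x + y) = d) : d + x = d :=
  hord _ _ ⟨y, by rw [add_assoc, h]⟩ ⟨x, rfl⟩

variable [HasDistribNeg T]

theorem circ_add (a b : T) : circ (a + b) = circ a + circ b := by
  rw [circ, circ, circ, symm_add, add_add_add_comm]

theorem mul_circ (a b : T) : a * circ b = circ (a * b) := by
  rw [circ, circ, mul_add, mul_neg]

theorem circ_neg (a : T) : circ (-a) = circ a := by
  rw [circ, circ, neg_neg, add_comm]

theorem circ_zero : circ (0 : T) = 0 := by simp [circ]

theorem CircGE.mul_left {a b : T} (h : CircGE a b) (c : T) : CircGE (c * a) (c * b) := by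
  obtain ⟨_, ⟨x, rfl⟩, rfl⟩ := h
  exact ⟨_, ⟨c * x, rfl⟩, by rw [mul_add, mul_circ]⟩

theorem CircGE.refl (a : T) : CircGE a a := ⟨_, ⟨0, rfl⟩, by rw [circ_zero, add_zero]⟩

theorem CircGE.sum {ι : Type*} (s : Finset ι) {f g : ι → T} (h : ∀ i ∈ s, CircGE (f i) (g i)) :
    CircGE (∑ i ∈ s, f i) (∑ i ∈ s, g i) := by
  classical
  induction s using Finset.induction_on with
  | empty => exact CircGE.refl _
  | insert a s ha ih =>
    obtain ⟨_, ⟨x, rfl⟩, hx⟩ := ih fun i hi => h i (Finset.mem_insert_of_mem hi)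
    obtain ⟨_, ⟨y, rfl⟩, hy⟩ := h a (Finset.mem_insert_self a s)
    refine ⟨_, ⟨y + x, rfl⟩, ?_⟩
    rw [Finset.sum_insert ha, Finset.sum_insert ha, hx, hy, circ_add, add_add_add_comm]

theorem circ_add_self (hord : NaturallyOrdered T) (hcirc : ∀ a : T, circ a + circ a = circ a)
    (a : T) : circ a + a = circ a :=
  hord.add_eq_left (hcirc a)

theorem circ_add_nsmul (hord : NaturallyOrdered T) (hcirc : ∀ a : T, circ a + circ a = circ a)
    (a : T) (l : ℕ) : circ a + l • a = circ a := by
  induction l with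
  | zero => rw [zero_nsmul, add_zero]
  | succ l ih => rw [succ_nsmul, ← add_assoc, ih, circ_add_self hord hcirc]

theorem nsmul_add_nsmul_neg (hord : NaturallyOrdered T)
    (hcirc : ∀ a : T, circ a + circ a = circ a) (a : T) (l m : ℕ) :
    (l + 1) • a + (m + 1) • -a = circ a := by
  calc (l + 1) • a + (m + 1) • -a = circ a + l • a + m • -a := by
        rw [succ_nsmul, succ_nsmul, circ]
        generalize -a = b
        abel
    _ = circ a := by
        rw [circ_add_nsmul hord hcirc, ← circ_neg, circ_add_nsmul hord hcirc]

/-- One monomial `w` of the transfer principle: the multiplicities `l, l'` of `w, -w` in the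
first sum have the same difference as the multiplicities `d + m, d' + m'` in the second one. The
summand `y` is a part of `m • w + m' • -w`. -/
theorem exists_circ_of_multiplicities (hord : NaturallyOrdered T)
    (hcirc : ∀ a : T, circ a + circ a = circ a) (w : T) (l l' d d' m m' : ℕ)
    (h : (l : ℤ) - l' = (d + m : ℕ) - (d' + m' : ℕ)) (hd : d ≠ 0 → d' + m' = 0)
    (hd' : d' ≠ 0 → d + m = 0) :
    ∃ y z c : T, y + z = m • w + m' • -w ∧
      l • w + l' • -w = (d • w + d' • -w) + y + circ c := by
  rcases Nat.eq_zero_or_pos l with rfl | hl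
  · -- Only `-w` occurs.
    have hd0 : d = 0 := by by_contra h0; have := hd h0; omega
    subst hd0
    obtain ⟨j, hj⟩ : ∃ j, m' = (l' - d') + j := ⟨m' - (l' - d'), by
      by_cases h0 : d' = 0
      · omega
      · have := hd' h0; omega⟩
    obtain ⟨i, hi⟩ : ∃ i, l' = d' + i := ⟨l' - d', by
      by_cases h0 : d' = 0
      · omega
      · have := hd' h0; omega⟩
    have hij : m' = i + j := by omega
    refine ⟨i • -w, m • w + j • -w, 0, ?_, ?_⟩
    · rw [hij, add_nsmul]; abel
    · rw [hi, add_nsmul, circ_zero, zero_nsmul]; abel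
  rcases Nat.eq_zero_or_pos l' with rfl | hl'
  · -- Only `w` occurs.
    have hd0 : d' = 0 := by by_contra h0; have := hd' h0; omega
    subst hd0
    obtain ⟨i, hi⟩ : ∃ i, l = d + i := ⟨l - d, by
      by_cases h0 : d = 0
      · omega
      · have := hd h0; omega⟩
    obtain ⟨j, hij⟩ : ∃ j, m = i + j := ⟨m - i, by
      by_cases h0 : d = 0
      · omega
      · have := hd h0; omega⟩
    refine ⟨i • w, j • w + m' • -w, 0, ?_, ?_⟩
    · rw [hij, add_nsmul]; abel
    · rw [hi, add_nsmul, circ_zero, zero_nsmul]; abel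
  -- Both `w` and `-w` occur, and `w°` absorbs all their copies.
  obtain ⟨l, rfl⟩ := Nat.exists_eq_succ_of_ne_zero hl.ne'
  obtain ⟨l', rfl⟩ := Nat.exists_eq_succ_of_ne_zero hl'.ne'
  refine ⟨0, m • w + m' • -w, w, zero_add _, ?_⟩
  rw [add_zero, nsmul_add_nsmul_neg hord hcirc, add_comm _ (circ w), ← add_assoc,
    circ_add_nsmul hord hcirc, ← circ_neg, circ_add_nsmul hord hcirc]

/-- Transfer principle. The formal sums `L` and `D + N` become equal once `p` and `-p` are allowed
to cancel, the terms of `D + N` with a monomial of `D` have the sign it has in `D`, and the value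
of `D` absorbs that of `N`. Then the value of `L` is that of `D` up to an element of `T°`. -/
theorem circGE_evalSigned {P : Type*} [CommMonoid P] (hord : NaturallyOrdered T)
    (hcirc : ∀ a : T, circ a + circ a = circ a) (ψ : P →* T) (L D N : SignedSum P)
    (hLDN : ∀ p, (L.coeff (1, p) : ℤ) - L.coeff (-1, p) =
      (D + N).coeff (1, p) - (D + N).coeff (-1, p))
    (hsign : ∀ g h, D.coeff g ≠ 0 → (D + N).coeff h ≠ 0 → g.2 = h.2 → g.1 = h.1)
    (hN : evalSigned ψ D + evalSigned ψ N = evalSigned ψ D) :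
    CircGE (evalSigned ψ L) (evalSigned ψ D) := by
  classical
  let s : Finset P := (L.coeff.support ∪ D.coeff.support ∪ N.coeff.support).image Prod.snd
  have hs : ∀ x, x = L ∨ x = D ∨ x = N → ∀ g, x.coeff g ≠ 0 → g.2 ∈ s := by
    intro x hx g hg
    refine Finset.mem_image_of_mem _ ?_
    simp only [Finset.mem_union, Finsupp.mem_support_iff]
    rcases hx with rfl | rfl | rfl <;> tauto
  have key : ∀ p, ∃ y z c : T,
      y + z = N.coeff (1, p) • ψ p + N.coeff (-1, p) • -ψ p ∧
      L.coeff (1, p) • ψ p + L.coeff (-1, p) • -ψ p =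
        (D.coeff (1, p) • ψ p + D.coeff (-1, p) • -ψ p) + y + circ c := by
    intro p
    refine exists_circ_of_multiplicities hord hcirc _ _ _ _ _ _ _ (hLDN p) ?_ ?_
    · intro h
      by_contra h'
      exact absurd (hsign (1, p) (-1, p) h h' rfl) (by simp)
    · intro h
      by_contra h'
      exact absurd (hsign (-1, p) (1, p) h h' rfl) (by simp)
  choose y z c hyz hL using key
  have hNs := evalSigned_eq_sum ψ N s (hs N (by tauto))
  simp only [← hyz, Finset.sum_add_distrib] at hNs
  refine ⟨_, ⟨∑ p ∈ s, c p, rfl⟩, ?_⟩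
  have hsum : circ (∑ p ∈ s, c p) = ∑ p ∈ s, circ (c p) :=
    map_sum ({ toFun := circ, map_zero' := circ_zero, map_add' := circ_add } : T →+ T) c s
  rw [hNs] at hN
  rw [hsum, evalSigned_eq_sum ψ L s (hs L (by tauto)), Finset.sum_congr rfl fun p _ => hL p,
    Finset.sum_add_distrib, Finset.sum_add_distrib, ← evalSigned_eq_sum ψ D s (hs D (by tauto)),
    hord.add_eq_left hN]

end Absorption

/-! ### Permutations with the same edges -/

/-- The exponent vector of the monomial `∏ i, x (i, p i)`. -/
noncomputable def edges {α : Type*} [Fintype α] (p : Perm α) : α × α →₀ ℕ :=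
  ∑ i, Finsupp.single (i, p i) 1

section Edges

variable {α : Type*} [Fintype α] [DecidableEq α]

theorem edges_apply (p : Perm α) (i j : α) : edges p (i, j) = if p i = j then 1 else 0 := by
  rw [edges, Finsupp.finsetSum_apply, Finset.sum_eq_single i]
  · simp [Finsupp.single_apply]
  · intro a _ ha
    simp [ha]
  · simp

theorem sum_edges_apply_le (ts : List (Perm α)) (i j : α) :
    (ts.map edges).sum (i, j) ≤ ts.length := by
  induction ts with
  | nil => simp
  | cons t ts ih =>
    simp only [List.map_cons, List.sum_cons, Finsupp.add_apply, List.length_cons, edges_apply]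
    split_ifs <;> omega

/-- If the edges of the permutations `p` and `ts` are, with multiplicities, those of `q` and of
copies of `π`, then the products of the signatures agree: `p` is turned into `q` by exchanging its
values successively with the members of `ts`. -/
theorem sign_eq_of_edges_eq (π : Perm α) (ts : List (Perm α)) (p q : Perm α)
    (h : edges p + (ts.map edges).sum = edges q + ts.length • edges π) :
    Perm.sign p * (ts.map Perm.sign).prod = Perm.sign q * Perm.sign π ^ ts.length := by
  induction ts generalizing p with
  | nil =>
    have hpq : p = q := by
      ext i
      have := DFunLike.congr_fun h (i, q i)
      simp only [List.map_nil, List.sum_nil, List.length_nil, zero_nsmul, add_zero,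
        edges_apply] at this
      simpa using this
    simp [hpq]
  | cons t ts ih =>
    -- At `i`, the edge of `π` occurs at least `ts.length + 1` times, at most `ts.length` of them
    -- from `ts`.
    have hswap : ∀ i, t i ≠ π i → p i = π i := by
      intro i hi
      by_contra hp
      have h1 := DFunLike.congr_fun h (i, π i)
      have h2 := sum_edges_apply_le ts i (π i)
      simp only [List.map_cons, List.sum_cons, List.length_cons, Finsupp.add_apply,
        Finsupp.smul_apply, edges_apply, smul_eq_mul, if_neg hp, if_neg hi, if_true] at h1
      omega
    -- Where `t` differs from `π`, exchange the values of `p` and `t`.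
    let p' : Perm α := p * π⁻¹ * t
    have hp' : ∀ i, t i ≠ π i → p' i = t i := by
      intro i hi
      obtain ⟨j, hj⟩ := π.surjective (t i)
      have hpj : p j = π j := hswap j fun h' => hi (by
        rw [t.injective (h'.trans hj)] at hj
        exact hj.symm)
      change p (π⁻¹ (t i)) = t i
      rw [← hj, Perm.inv_def, Equiv.symm_apply_apply, hpj]
    have hedges : edges p' + edges π = edges p + edges t := by
      simp only [edges, ← Finset.sum_add_distrib]
      refine Finset.sum_congr rfl fun i _ => ?_
      by_cases hi : t i = π i
      · have : p' i = p i := by simp [p', hi]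
        rw [this, hi]
      · rw [hp' i hi, hswap i hi, add_comm]
    have h' : edges p' + (ts.map edges).sum = edges q + ts.length • edges π := by
      refine add_right_cancel (b := edges π) ?_
      rw [List.map_cons, List.sum_cons, List.length_cons, succ_nsmul, ← add_assoc, ← add_assoc,
        ← hedges] at h
      rw [← h]; abel
    have h1 : Perm.sign p = Perm.sign p' * Perm.sign π * Perm.sign t := by
      simp only [p', Perm.sign_mul, Perm.sign_inv]
      rcases Int.units_eq_one_or (Perm.sign π) with h | h <;>
        rcases Int.units_eq_one_or (Perm.sign t) with h' | h' <;> simp [h, h']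
    rw [List.map_cons, List.prod_cons, List.length_cons, pow_succ, ← mul_assoc (Perm.sign q),
      ← ih p' h', h1]
    rcases Int.units_eq_one_or (Perm.sign t) with h | h <;>
      simp [h, mul_comm, mul_assoc]

end Edges

/-! ### The generic matrix -/

/-- The formal signed sums of monomials in the entries of an `n × n` matrix. -/
abbrev SignedPoly (n : ℕ) : Type := SignedSum (Multiplicative (Fin n × Fin n →₀ ℕ))

/-- The matrix whose entries are distinct variables, over the formal signed sums. -/
noncomputable def genericMatrix (n : ℕ) : Matrix (Fin n) (Fin n) (SignedPoly n) :=
  Matrix.of fun i j => MonoidAlgebra.single (1, Multiplicative.ofAdd (Finsupp.single (i, j) 1)) 1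

theorem monomialOneHom_eq (R : Type*) [CommSemiring R] {V : Type*} (p : Multiplicative (V →₀ ℕ)) :
    MvPolynomial.monomialOneHom R V p = MvPolynomial.monomial p.toAdd 1 := rfl

/-- The value of a monomial at the matrix `A`. -/
noncomputable def monomialAt {T : Type*} [CommSemiring T] {n : ℕ} (A : Matrix (Fin n) (Fin n) T) :
    Multiplicative (Fin n × Fin n →₀ ℕ) →* T :=
  ((MvPolynomial.aeval (R := ℕ) fun v : Fin n × Fin n => A v.1 v.2 :
    MvPolynomial (Fin n × Fin n) ℕ →* T)).comp (MvPolynomial.monomialOneHom ℕ (Fin n × Fin n))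

theorem genericMatrix_map_monomialAt {T : Type*} [CommSemiring T] [HasDistribNeg T] {n : ℕ}
    (A : Matrix (Fin n) (Fin n) T) :
    (genericMatrix n).map (evalSigned (monomialAt A)) = A := by
  ext i j
  simp [genericMatrix, evalSigned_single, monomialAt, monomialOneHom_eq,
    MvPolynomial.aeval_monomial]

/-- Forgetting the distinction between `p + (-p)` and `0` gives ordinary polynomials. -/
noncomputable def toPoly (n : ℕ) : SignedPoly n →+* MvPolynomial (Fin n × Fin n) ℤ :=
  evalSigned (MvPolynomial.monomialOneHom ℤ (Fin n × Fin n))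

theorem coeff_toPoly {n : ℕ} (x : SignedPoly n) (p : Multiplicative (Fin n × Fin n →₀ ℕ)) :
    (toPoly n x).coeff p.toAdd = (x.coeff (1, p) : ℤ) - x.coeff (-1, p) := by
  induction x using MonoidAlgebra.induction_linear with
  | zero => simp
  | add x y hx hy => simp [hx, hy]; ring
  | single g c =>
    obtain ⟨s, q⟩ := g
    have h : MonoidAlgebra.single (s, q) c = c • MonoidAlgebra.single (s, q) 1 := by simp
    rw [h, map_nsmul, toPoly, evalSigned_single, MvPolynomial.coeff_smul,
      monomialOneHom_eq]
    by_cases hq : q = p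
    · subst hq
      rcases Int.units_eq_one_or s with rfl | rfl
      · simp
      · simp [signHom_neg_one]
    · have hq' : ¬q.toAdd = p.toAdd := hq
      rcases Int.units_eq_one_or s with rfl | rfl <;>
        simp [signHom_neg_one, MvPolynomial.coeff_monomial, hq, hq']

theorem toPoly_single (n : ℕ) (s : ℤˣ) :
    toPoly n (MonoidAlgebra.single (s, 1) 1) = (s : ℤ) := by
  rw [toPoly, evalSigned_single, map_one, mul_one]
  rcases Int.units_eq_one_or s with rfl | rfl <;> simp [signHom_neg_one]

/-- Cancelling opposite terms turns the generic matrix into the matrix of indeterminates. -/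
theorem det_map_toPoly_ne_zero (n : ℕ) : ((genericMatrix n).map (toPoly n)).det ≠ 0 := by
  have h : (genericMatrix n).map (toPoly n) = Matrix.mvPolynomialX (Fin n) (Fin n) ℤ := by
    ext1 i j
    simp [genericMatrix, toPoly, evalSigned_single, MvPolynomial.X,
      monomialOneHom_eq]
  rw [h]
  exact Matrix.det_mvPolynomialX_ne_zero (Fin n) ℤ

theorem bijTerm_genericMatrix {n k : ℕ} (f g : Fin k → Fin n) (σ : Perm (Fin k)) :
    (-1) ^ invCount σ * ∏ i, (genericMatrix n).submatrix f g i (σ i) = MonoidAlgebra.single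
      (Perm.sign σ, Multiplicative.ofAdd (∑ i, Finsupp.single (f i, g (σ i)) 1)) 1 := by
  rw [SignedSum.neg_one_eq, MonoidAlgebra.single_pow, Prod.pow_mk, neg_one_pow_invCount, one_pow,
    one_pow]
  have : ∀ i, (genericMatrix n).submatrix f g i (σ i) =
      MonoidAlgebra.single (1, Multiplicative.ofAdd (Finsupp.single (f i, g (σ i)) 1)) 1 :=
    fun _ => rfl
  simp only [this]
  rw [MonoidAlgebra.prod_single, MonoidAlgebra.single_mul_single, Finset.prod_const_one, mul_one]
  congr 1
  rw [Prod.ext_iff]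
  simp [Prod.fst_prod, Prod.snd_prod, ofAdd_sum]

theorem bijDet_genericMatrix {n k : ℕ} (f g : Fin k → Fin n) :
    bijDet ((genericMatrix n).submatrix f g) = ∑ σ : Perm (Fin k),
      MonoidAlgebra.single
        (Perm.sign σ, Multiplicative.ofAdd (∑ i, Finsupp.single (f i, g (σ i)) 1)) 1 :=
  Finset.sum_congr rfl fun σ _ => bijTerm_genericMatrix f g σ

theorem exists_eq_of_coeff_sum_single_ne_zero {M ι : Type*} {s : Finset ι} {f : ι → M} {g : M}
    (h : (∑ i ∈ s, MonoidAlgebra.single (f i) (1 : ℕ)).coeff g ≠ 0) : ∃ i ∈ s, g = f i := by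
  rw [MonoidAlgebra.coeff_sum, Finsupp.finsetSum_apply] at h
  obtain ⟨i, hi, h⟩ := Finset.exists_ne_zero_of_sum_ne_zero h
  refine ⟨i, hi, ?_⟩
  by_contra hne
  rw [MonoidAlgebra.coeff_single, Finsupp.single_eq_of_ne hne] at h
  exact h rfl

theorem exists_eq_mul_of_coeff_mul_ne_zero {M : Type*} [Monoid M] {x y : MonoidAlgebra ℕ M} {g : M}
    (h : (x * y).coeff g ≠ 0) :
    ∃ a b, x.coeff a ≠ 0 ∧ y.coeff b ≠ 0 ∧ g = a * b := by
  classical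
  have := MonoidAlgebra.support_coeff_mul_subset x y (Finsupp.mem_support_iff.2 h)
  obtain ⟨a, ha, b, hb, rfl⟩ := Finset.mem_mul.1 this
  exact ⟨a, b, Finsupp.mem_support_iff.1 ha, Finsupp.mem_support_iff.1 hb, rfl⟩

theorem tdet_genericMatrix (n : ℕ) :
    tdet (genericMatrix n) = ∑ σ : Perm (Fin n),
      MonoidAlgebra.single (Perm.sign σ, Multiplicative.ofAdd (edges σ)) 1 :=
  bijDet_genericMatrix id id

/-- The terms of a power of the generic determinant come from lists of permutations. -/
theorem exists_list_of_coeff_tdet_pow_ne_zero {n r : ℕ}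
    {g : ℤˣ × Multiplicative (Fin n × Fin n →₀ ℕ)}
    (h : (tdet (genericMatrix n) ^ r).coeff g ≠ 0) :
    ∃ ts : List (Perm (Fin n)), ts.length = r ∧ g.1 = (ts.map Perm.sign).prod ∧
      g.2.toAdd = (ts.map edges).sum := by
  induction r generalizing g with
  | zero =>
    rw [pow_zero, MonoidAlgebra.one_def, MonoidAlgebra.coeff_single] at h
    have hg : g = 1 := by
      by_contra hne
      exact h (Finsupp.single_eq_of_ne hne)
    exact ⟨[], rfl, by simp [hg], by simp [hg]⟩
  | succ r ih =>
    rw [pow_succ'] at h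
    obtain ⟨a, b, ha, hb, rfl⟩ := exists_eq_mul_of_coeff_mul_ne_zero h
    obtain ⟨ts, h0, h1, h2⟩ := ih hb
    rw [tdet_genericMatrix] at ha
    obtain ⟨t, -, rfl⟩ := exists_eq_of_coeff_sum_single_ne_zero ha
    exact ⟨t :: ts, by simp [h0], by simp [h1], by simp [h2]⟩

/-- The permutation of `[n]` that is `σ` from `I` to `J` and increasing from `Iᶜ` to `Jᶜ`. -/
def extendPerm {n k : ℕ} (I J : KSubset n k) (σ : Perm (Fin k)) : Perm (Fin n) :=
  I.split.symm.trans ((Equiv.sumCongr σ (Equiv.refl (Fin (n - k)))).trans J.split)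

theorem sign_extendPerm {n k : ℕ} (I J : KSubset n k) (σ : Perm (Fin k)) :
    Perm.sign (extendPerm I J σ) = splitSign I J * Perm.sign σ := by
  have h : extendPerm I J σ = ((I.split.symm.trans (Equiv.sumCongr σ
      (Equiv.refl (Fin (n - k))))).trans I.split).trans (I.split.symm.trans J.split) := by
    ext; simp [extendPerm]
  rw [h, Perm.sign_trans, Perm.sign_symm_trans_trans, splitSign]
  congr 1
  have := Perm.sign_sumCongr σ (1 : Perm (Fin (n - k)))
  rwa [Perm.sign_one, mul_one] at this

/-- The edges of the extension from `Iᶜ` to `Jᶜ` do not depend on `σ`. -/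
theorem edges_extendPerm {n k : ℕ} (I J : KSubset n k) (σ : Perm (Fin k)) :
    edges (extendPerm I J σ) =
      ∑ i, Finsupp.single (I.split (Sum.inl i), J.split (Sum.inl (σ i))) 1 +
      ∑ i, Finsupp.single (I.split (Sum.inr i), J.split (Sum.inr i)) 1 := by
  rw [edges, ← I.split.sum_comp, Fintype.sum_sum_type]
  simp [extendPerm]

/-! ### The tropical Jacobi identity -/

theorem compound_genericMatrix {n k : ℕ} (I J : KSubset n k) :
    compound k (genericMatrix n) I J = ∑ σ : Perm (Fin k), MonoidAlgebra.single
      (Perm.sign σ, Multiplicative.ofAdd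
        (∑ i, Finsupp.single (I.split (Sum.inl i), J.split (Sum.inl (σ i))) 1)) 1 := by
  rw [compound_eq_bijDet]
  exact bijDet_genericMatrix _ _

/-- The terms of `det ^ r * A^∧k` with the monomial of a term built on `r` copies of a single
permutation `π` all have the sign of that term. -/
theorem sign_eq_of_monomial_eq {n k r : ℕ} (π : Perm (Fin n)) (I J : KSubset n k)
    {g h : ℤˣ × Multiplicative (Fin n × Fin n →₀ ℕ)}
    (hg : (MonoidAlgebra.single (Perm.sign π, Multiplicative.ofAdd (edges π)) 1 ^ r *
      compound k (genericMatrix n) I J).coeff g ≠ 0)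
    (hh : (tdet (genericMatrix n) ^ r * compound k (genericMatrix n) I J).coeff h ≠ 0)
    (hgh : g.2 = h.2) : g.1 = h.1 := by
  obtain ⟨a, b, ha, hb, rfl⟩ := exists_eq_mul_of_coeff_mul_ne_zero hg
  obtain ⟨c, d, hc, hd, rfl⟩ := exists_eq_mul_of_coeff_mul_ne_zero hh
  have haπ : a = (Perm.sign π, Multiplicative.ofAdd (edges π)) ^ r := by
    rw [MonoidAlgebra.single_pow, one_pow, MonoidAlgebra.coeff_single] at ha
    by_contra hne
    exact ha (Finsupp.single_eq_of_ne hne)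
  rw [compound_genericMatrix] at hb hd
  obtain ⟨σ, -, rfl⟩ := exists_eq_of_coeff_sum_single_ne_zero hb
  obtain ⟨τ, -, rfl⟩ := exists_eq_of_coeff_sum_single_ne_zero hd
  obtain ⟨ts, hlen, hc1, hc2⟩ := exists_list_of_coeff_tdet_pow_ne_zero hc
  have hmon := congrArg Multiplicative.toAdd hgh
  simp only [Prod.snd_mul, toAdd_mul, hc2, haπ, Prod.pow_snd, toAdd_pow, toAdd_ofAdd] at hmon
  have hedges : edges (extendPerm I J τ) + (ts.map edges).sum =
      edges (extendPerm I J σ) + ts.length • edges π := by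
    rw [edges_extendPerm, edges_extendPerm, hlen, add_right_comm, add_comm _ (ts.map edges).sum,
      ← hmon]
    abel
  have hsign := sign_eq_of_edges_eq π ts _ _ hedges
  rw [sign_extendPerm, sign_extendPerm, mul_assoc, mul_assoc, mul_right_inj, hlen] at hsign
  simp only [Prod.fst_mul, hc1, haπ, Prod.pow_fst]
  rw [mul_comm, ← hsign, mul_comm]

section Jacobi

variable {T : Type*} [CommSemiring T] [HasDistribNeg T]

/-- A power of a sum is the power of its first summand plus other terms. -/
theorem exists_add_pow_eq {S : Type*} [CommSemiring S] (a b : S) (r : ℕ) :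
    ∃ c, (a + b) ^ r = a ^ r + c := by
  induction r with
  | zero => exact ⟨0, by simp⟩
  | succ r ih =>
    obtain ⟨c, hc⟩ := ih
    exact ⟨a ^ r * b + c * (a + b), by rw [pow_succ, hc]; ring⟩

/-- The tropical Jacobi identity, for a matrix whose determinant equals its term at `π`. The
hypothesis `hIJ` makes the sign `splitSign I J` invisible in `T`. -/
theorem circGE_compound_tadj (hord : NaturallyOrdered T)
    (hcirc : ∀ a : T, circ a + circ a = circ a) {n k r : ℕ} (hr : n - k = r + 1)
    (A : Matrix (Fin n) (Fin n) T) (π : Perm (Fin n))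
    (hπ : tdet A = (-1) ^ invCount π * ∏ i, A i (π i)) (I J : KSubset n k)
    (hIJ : splitSign I J = 1 ∨ (-1 : T) = 1) :
    CircGE (compound (n - k) (tadj A) J.compl I.compl) (tdet A ^ r * compound k A I J) := by
  set X := genericMatrix n with hX
  set Φ := evalSigned (monomialAt A) with hΦ
  have hXA : X.map Φ = A := genericMatrix_map_monomialAt A
  have hΦneg : Φ (-1) = -1 := evalSigned_neg_one _
  let ε : SignedPoly n := MonoidAlgebra.single (splitSign I J, 1) 1
  let p : SignedPoly n := MonoidAlgebra.single (Perm.sign π, Multiplicative.ofAdd (edges π)) 1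
  have hε : Φ ε = 1 := by
    rw [hΦ, evalSigned_single, map_one, mul_one]
    rcases hIJ with h | h
    · rw [h, map_one]
    · rcases Int.units_eq_one_or (splitSign I J) with h' | h' <;> rw [h']
      · exact map_one _
      · rw [signHom_neg_one, h]
  have hp : Φ p = tdet A := by
    have h : p = (-1) ^ invCount π * ∏ i, X i (π i) := (bijTerm_genericMatrix id id π).symm
    rw [h, hπ, ← hXA]
    simp [hΦneg]
  obtain ⟨q, hq⟩ : ∃ q, tdet X = p + q := by
    rw [hX, tdet_genericMatrix]
    exact ⟨_, (Finset.add_sum_erase _ _ (Finset.mem_univ π)).symm⟩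
  obtain ⟨c, hc⟩ := exists_add_pow_eq p q r
  rw [← hq] at hc
  have hC : Φ (compound k X I J) = compound k A I J := by rw [map_compound Φ hΦneg, hXA]
  have hdet : Φ (tdet X) = tdet A := by rw [map_tdet Φ hΦneg, hXA]
  have hDN : ε * (p ^ r * compound k X I J) + ε * (c * compound k X I J) =
      ε * (tdet X ^ r * compound k X I J) := by rw [hc]; ring
  have hL : Φ (compound (n - k) (tadj X) J.compl I.compl) =
      compound (n - k) (tadj A) J.compl I.compl := by
    rw [map_compound Φ hΦneg, map_tadj Φ hΦneg, hXA]
  have hD : Φ (ε * (p ^ r * compound k X I J)) = tdet A ^ r * compound k A I J := by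
    rw [map_mul, map_mul, map_pow, hε, hp, hC, one_mul]
  have hpoly : toPoly n (compound (n - k) (tadj X) J.compl I.compl) =
      toPoly n (ε * (tdet X ^ r * compound k X I J)) := by
    have hneg : toPoly n (-1) = -1 := evalSigned_neg_one _
    rw [map_compound (toPoly n) hneg, map_tadj (toPoly n) hneg, tadj_eq_adjugate,
      compound_adjugate_compl _ (det_map_toPoly_ne_zero n) hr, map_mul, map_mul, map_pow,
      map_compound (toPoly n) hneg, map_tdet (toPoly n) hneg, tdet_eq_det, toPoly_single]
  rw [← hL, ← hD]
  refine circGE_evalSigned hord hcirc _ _ _ (ε * (c * compound k X I J)) ?_ ?_ ?_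
  · -- Over `ℤ` this is the classical identity.
    intro m
    rw [hDN, ← coeff_toPoly, ← coeff_toPoly, hpoly]
  · intro g h hg hh hgh
    rw [hDN] at hh
    obtain ⟨a, b, ha, hb, rfl⟩ := exists_eq_mul_of_coeff_mul_ne_zero hg
    obtain ⟨a', b', ha', hb', rfl⟩ := exists_eq_mul_of_coeff_mul_ne_zero hh
    have hε : ∀ a, ε.coeff a ≠ 0 → a = (splitSign I J, 1) := by
      intro a ha
      by_contra hne
      exact ha (Finsupp.single_eq_of_ne hne)
    rw [hε a ha, hε a' ha'] at hgh ⊢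
    simp only [Prod.snd_mul, one_mul] at hgh
    rw [Prod.fst_mul, Prod.fst_mul, sign_eq_of_monomial_eq π I J hb hb' hgh]
  · rw [← map_add, hDN, ← hΦ, hD, map_mul, map_mul, map_pow, hε, hdet, hC, one_mul]

/-- If an invertible sum of two elements is always one of them, then the determinant of a
nonsingular matrix is one of its terms. -/
theorem exists_tdet_eq_term (hsel : ∀ a b : T, IsUnit (a + b) → a + b = a ∨ a + b = b) {n : ℕ}
    (A : Matrix (Fin n) (Fin n) T) (hA : Nonsing A) :
    ∃ π : Perm (Fin n), tdet A = (-1) ^ invCount π * ∏ i, A i (π i) := by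
  classical
  have key : ∀ (s : Finset (Perm (Fin n))), s.Nonempty → ∀ f : Perm (Fin n) → T,
      IsUnit (∑ i ∈ s, f i) → ∃ i ∈ s, ∑ i ∈ s, f i = f i := by
    intro s hs f
    induction hs using Finset.Nonempty.cons_induction with
    | singleton a => exact fun _ => ⟨a, by simp⟩
    | cons a s ha hs ih =>
      rw [Finset.sum_cons]
      intro hu
      rcases hsel _ _ hu with h | h
      · exact ⟨a, by simp, h⟩
      · rw [h] at hu ⊢
        obtain ⟨i, hi, h⟩ := ih hu
        exact ⟨i, by simp [hi], h⟩
  obtain ⟨π, -, h⟩ := key Finset.univ ⟨1, Finset.mem_univ _⟩ _ hA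
  exact ⟨π, h⟩

theorem bijDet_mul_const {k : ℕ} (B : Matrix (Fin k) (Fin k) T) (u : T) :
    bijDet (Matrix.of fun i j => B i j * u) = bijDet B * u ^ k := by
  simp [bijDet, Finset.prod_mul_distrib, Finset.sum_mul, mul_assoc]

theorem compound_quasiInv {n k : ℕ} (A : Matrix (Fin n) (Fin n) T) (I J : KSubset n k) :
    compound k (quasiInv A) I J = compound k (tadj A) I J * Ring.inverse (tdet A) ^ k := by
  rw [compound_eq_bijDet, compound_eq_bijDet, ← bijDet_mul_const]
  rfl

/-- The compound matrix of full order has the determinant as its only entry. -/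
theorem compound_eq_tdet {n k : ℕ} (h : k = n) (A : Matrix (Fin n) (Fin n) T)
    (I J : KSubset n k) : compound k A I J = tdet A := by
  have huniv : ∀ I : KSubset n k, ∀ i, i ∈ I.1 := fun I => by
    rw [← Finset.eq_univ_iff_forall, ← Finset.card_eq_iff_eq_univ, I.2, h, Fintype.card_fin]
  let e (I : KSubset n k) : Fin n ≃o {i // i ∈ I.1} :=
    { toFun i := ⟨i, huniv I i⟩
      invFun i := i.1
      map_rel_iff' := Iff.rfl }
  exact (bijDet_submatrix_orderIso (e I) (e J) _).symm

theorem compound_of_eq_zero {n k : ℕ} (h : k = 0) (A : Matrix (Fin n) (Fin n) T)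
    (I J : KSubset n k) : compound k A I J = 1 := by
  subst h
  rw [compound_eq_bijDet, bijDet]
  simp [invCount]

/-- Since `A^∇ = (det A)⁻¹ adj A`, the powers of `det A` cancel when the identity for `adj A` is
multiplied by `det A * (det A)⁻¹ ^ (n - k)`. For `k = n` both sides are `det A`. -/
theorem circGE_compound_quasiInv (hord : NaturallyOrdered T)
    (hcirc : ∀ a : T, circ a + circ a = circ a)
    (hsel : ∀ a b : T, IsUnit (a + b) → a + b = a ∨ a + b = b) {n k : ℕ} (hk : k ≤ n)
    (A : Matrix (Fin n) (Fin n) T) (hA : Nonsing A) (I J : KSubset n k)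
    (hIJ : splitSign I J = 1 ∨ (-1 : T) = 1) :
    CircGE (tdet A * compound (n - k) (quasiInv A) J.compl I.compl) (compound k A I J) := by
  rcases Nat.eq_zero_or_pos (n - k) with h0 | hpos
  · rw [compound_of_eq_zero h0, mul_one, compound_eq_tdet (by omega)]
    exact CircGE.refl _
  · obtain ⟨r, hr⟩ := Nat.exists_eq_succ_of_ne_zero hpos.ne'
    obtain ⟨π, hπ⟩ := exists_tdet_eq_term hsel A hA
    have h := (circGE_compound_tadj hord hcirc hr A π hπ I J hIJ).mul_left
      (tdet A * Ring.inverse (tdet A) ^ (n - k))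
    have hu := Ring.mul_inverse_cancel _ hA
    have hpow : tdet A * Ring.inverse (tdet A) ^ (n - k) * tdet A ^ r = 1 := by
      rw [hr]
      calc tdet A * Ring.inverse (tdet A) ^ (r + 1) * tdet A ^ r
          = (tdet A * Ring.inverse (tdet A)) ^ (r + 1) := by ring
        _ = 1 := by rw [hu, one_pow]
    rw [← mul_assoc, hpow, one_mul] at h
    rw [compound_quasiInv]
    convert h using 1
    ring

theorem KSubset.compl_bijective {n k : ℕ} (hk : k ≤ n) :
    Function.Bijective (KSubset.compl : KSubset n k → KSubset n (n - k)) := by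
  constructor
  · intro I J h
    exact Subtype.ext (compl_injective (congrArg Subtype.val h))
  · intro I
    refine ⟨⟨I.1ᶜ, ?_⟩, Subtype.ext (compl_compl I.1)⟩
    rw [Finset.card_compl, I.2, Fintype.card_fin]
    omega

end Jacobi

/-- The modulus of `a + b` is that of `a` or of `b`; no element strictly below
an invertible one has the same modulus. -/
theorem IsTropicalWithModulus.add_eq_or {T M : Type*} [CommSemiring T] [HasDistribNeg T]
    [CommSemiring M] {μ : T →+* M} (h : IsTropicalWithModulus μ) (a b : T) (hu : IsUnit (a + b)) :
    a + b = a ∨ a + b = b := by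
  rcases h.semifield.total (μ a) (μ b) with ⟨c, hc⟩ | ⟨c, hc⟩
  · refine Or.inr (h.eq_of_le_of_modulus_eq b (a + b) ⟨a, add_comm a b⟩ ?_ (Or.inl hu)).symm
    rw [map_add, hc, ← add_assoc, h.semifield.add_self]
  · refine Or.inl (h.eq_of_le_of_modulus_eq a (a + b) ⟨b, rfl⟩ ?_ (Or.inl hu)).symm
    rw [map_add, hc, add_right_comm, h.semifield.add_self]

/-! ### The supertropical semiring -/

namespace Supertropical

theorem add_self_eq_nu (a : Supertropical) : a + a = nu a := add_of_eq rfl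

theorem circ_eq_nu (a : Supertropical) : circ a = nu a := add_self_eq_nu a

theorem naturallyOrdered : NaturallyOrdered Supertropical := by
  rintro a b ⟨c, hc⟩ ⟨d, hd⟩
  have hab : level a ≤ level b := by rw [hc, level_add]; exact le_max_left _ _
  have hba : level b ≤ level a := by rw [hd, level_add]; exact le_max_left _ _
  -- The summand `c` either leaves `a` unchanged or turns it into a ghost.
  have aux : ∀ {a b c : Supertropical}, level a = level b → b = a + c → b = a ∨ b = nu a := by
    intro a b c hl hb
    rcases lt_trichotomy (level a) (level c) with h | h | h
    · rw [hb, add_of_lt h] at hl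
      exact absurd hl h.ne
    · exact Or.inr (hb.trans (add_of_eq h))
    · exact Or.inl (hb.trans (add_of_gt h))
  have heq := le_antisymm hab hba
  rcases aux heq hc with h | h
  · exact h.symm
  · rcases aux heq.symm hd with h' | h'
    · exact h'
    · rw [h', h, nu_nu]

theorem circ_add_circ (a : Supertropical) : circ a + circ a = circ a := by
  rw [circ_eq_nu, add_self_eq_nu, nu_nu]

theorem not_isUnit_nu (a : Supertropical) : ¬IsUnit (nu a) := by
  intro h
  obtain ⟨b, hb⟩ := h.exists_right_inv
  cases a <;> cases b <;> simp [nu, one_def, bot_mul, mul_bot, ghost_mul_ghost,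
    ghost_mul_tangible] at hb

theorem add_eq_or (a b : Supertropical) (hu : IsUnit (a + b)) : a + b = a ∨ a + b = b := by
  rcases lt_trichotomy (level a) (level b) with h | h | h
  · exact Or.inr (add_of_lt h)
  · rw [add_of_eq h] at hu
    exact absurd hu (not_isUnit_nu a)
  · exact Or.inl (add_of_gt h)

theorem models_of_circGE {a b : Supertropical} (h : CircGE a b) : Models a b := by
  obtain ⟨_, ⟨x, rfl⟩, rfl⟩ := h
  rw [circ_eq_nu]
  cases x with
  | bot => exact ⟨⊥, rfl⟩
  | tangible r => exact ⟨(r : WithBot ℝ), rfl⟩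
  | ghost r => exact ⟨(r : WithBot ℝ), rfl⟩

end Supertropical

end SymTrop

theorem corollary3p3 :
    (∀ (T : Type*) (M : Type*) [CommSemiring T] [HasDistribNeg T] [CommSemiring M]
        (μ : T →+* M), SymTrop.IsTropicalWithModulus μ →
      ∀ (n : ℕ) (A : Matrix (Fin n) (Fin n) T), SymTrop.Nonsing A → ∀ k : ℕ, k ≤ n →
        SymTrop.CircGE
          (SymTrop.tdet A * (SymTrop.compound (n - k) (SymTrop.quasiInv A)).trace)
          (SymTrop.compound k A).trace ∧
        ((-1 : T) = 1 → ∀ I J : SymTrop.KSubset n k,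
          SymTrop.CircGE
            (SymTrop.tdet A * SymTrop.compound (n - k) (SymTrop.quasiInv A) J.compl I.compl)
            (SymTrop.compound k A I J))) ∧
    (∀ (n : ℕ) (A : Matrix (Fin n) (Fin n) SymTrop.Supertropical), SymTrop.Nonsing A →
      ∀ k : ℕ, k ≤ n → ∀ I J : SymTrop.KSubset n k,
        SymTrop.Supertropical.Models
          (SymTrop.tdet A * SymTrop.compound (n - k) (SymTrop.quasiInv A) J.compl I.compl)
          (SymTrop.compound k A I J)) := by
  constructor
  · intro T M _ _ _ μ hμ n A hA k hk
    have h := @SymTrop.circGE_compound_quasiInv T _ _ hμ.naturallyOrdered hμ.circ_add_circ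
      hμ.add_eq_or n k hk A hA
    refine ⟨?_, fun hone I J => h I J (Or.inr hone)⟩
    rw [Matrix.trace, ← (SymTrop.KSubset.compl_bijective hk).sum_comp, Finset.mul_sum]
    exact SymTrop.CircGE.sum _ fun I _ => h I I (Or.inl (SymTrop.splitSign_self I))
  · intro n A hA k hk I J
    exact SymTrop.Supertropical.models_of_circGE
      (SymTrop.circGE_compound_quasiInv SymTrop.Supertropical.naturallyOrdered
        SymTrop.Supertropical.circ_add_circ SymTrop.Supertropical.add_eq_or hk A hA I J
        (Or.inr rfl))
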